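/- Let $\Bbbk$ be a field of characteristic zero and $\Omega$ a set. An algebra (of type $\Omega$) is a linear space over $\Bbbk$ with bilinear operations $\circ_\omega$, $\omega\in\Omega$; a dialgebra is a linear space with bilinear operations $\vdash_\omega,\dashv_\omega$, $\omega\in\Omega$. For a variety $\mathfrak M$ of algebras (or dialgebras), i.e. the class of all those satisfying a given set of identities, let $\mathfrak M(n)$ be the space of multilinear polynomials of degree $n$ in $x_1,\dots,x_n$ in the free algebra $\mathfrak M\langle x_1,x_2,\dots\rangle$, and let $c_n(\mathfrak M)=\dim\mathfrak M(n)$ be the $n$th codimension (a cardinal, finite if $\Omega$ is finite). Let $\mathrm{di}\text{-}\mathrm{Alg}_0$ be the variety of dialgebras defined by the identities \[ (x\vdash_\omega y-x\dashv_\omega y)\vdash_\mu z=0,\qquad x\dashv_\mu(y\vdash_\omega z-y\dashv_\omega z)=0,\qquad \omega,\mu\in\Omega . \] For a pre-commutative (Zinbiel) algebra $Z$, i.e. a linear space with a bilinear product such that $(xy+yx)z=x(yz)$, and a dialgebra $D$, let $Z\boxtimes D$ be the space $Z\otimes D$ with the operations \[ (z\otimes a)\circ_\omega(w\otimes b)=zw\otimes(a\vdash_\omega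 b)+wz\otimes(a\dashv_\omega b). \] For a variety $\mathfrak V$ of dialgebras, let its enveloping variety $\widehat{\mathfrak V}$ be the variety of algebras generated by all $Z\boxtimes D$ with $Z$ pre-commutative and $D\in\mathfrak V$. A sequence $(c_n)_{n\ge1}$ of cardinals has polynomial growth if all $c_n$ are finite and there are constants $C,d$ with $c_n\le Cn^d$ for all $n\ge1$; it has subexponential growth if all $c_n$ are finite and for every real $a>1$ there is a constant $C$ with $c_n\le Ca^n$ for all $n\ge 1$; it has intermediate growth if it has subexponential but not polynomial growth. **Theorem.** Let $\mathfrak V\subseteq\mathrm{di}\text{-}\mathrm{Alg}_0$ be a variety of dialgebras. Then for all $n\ge1$ \[ c_n(\mathfrak V)\le n\,c_n(\widehat{\mathfrak V})\qquad\text{and}\qquad c_n(\widehat{\mathfrak V})\le n\,c_n(\mathfrak V). \] In particular, the sequence $c_n(\mathfrak V)$ has polynomial (respectively intermediate) growth if and only if $c_n(\widehat{\mathfrak V})$ does. -/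

import Mathlib

universe u v w

open scoped TensorProduct

/-- A (non-associative) algebra over `k`: a linear space with a family of bilinear operations
indexed by `Ω`. -/
structure OmegaAlg (k : Type u) [Field k] (Ω : Type v) where
  carrier : Type w
  [addCommGroup : AddCommGroup carrier]
  [module : Module k carrier]
  op : Ω → carrier →ₗ[k] carrier →ₗ[k] carrier

attribute [instance] OmegaAlg.addCommGroup OmegaAlg.module

/-- Non-associative words in the variables `x₀, x₁, …` with operation symbols from `Ω`. -/
inductive OmegaWord (Ω : Type v) : Type v
  | var : ℕ → OmegaWord Ω
  | op : Ω → OmegaWord Ω → OmegaWord Ω → OmegaWord Ω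

/-- The multiset of variables occurring in a word. -/
def OmegaWord.vars {Ω : Type v} : OmegaWord Ω → Multiset ℕ
  | .var i => {i}
  | .op _ s t => s.vars + t.vars

/-- The underlying space of the free algebra `Alg⟨x₀, x₁, …⟩`: non-associative polynomials. -/
abbrev OmegaPoly (k : Type u) [Field k] (Ω : Type v) : Type (max u v) :=
  OmegaWord Ω →₀ k

/-- `Alg(n)`: the multilinear polynomials of degree `n` in `x₀, …, x_{n-1}`. -/
def multilinearPoly (k : Type u) [Field k] (Ω : Type v) (n : ℕ) :
    Submodule k (OmegaPoly k Ω) :=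
  Finsupp.supported k k {t : OmegaWord Ω | t.vars = Multiset.range n}

namespace OmegaAlg

variable {k : Type u} [Field k] {Ω : Type v}

/-- The value of a word under the substitution `xᵢ ↦ a i`. -/
def evalWord (A : OmegaAlg.{u, v, w} k Ω) (a : ℕ → A.carrier) : OmegaWord Ω → A.carrier
  | .var i => a i
  | .op ω s t => A.op ω (A.evalWord a s) (A.evalWord a t)

/-- The value of a polynomial under the substitution `xᵢ ↦ a i`. -/
noncomputable def eval (A : OmegaAlg.{u, v, w} k Ω) (a : ℕ → A.carrier) :
    OmegaPoly k Ω →ₗ[k] A.carrier :=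
  Finsupp.linearCombination k (A.evalWord a)

/-- `f = 0` is an identity on `A`. -/
def Satisfies (A : OmegaAlg.{u, v, w} k Ω) (f : OmegaPoly k Ω) : Prop :=
  ∀ a : ℕ → A.carrier, A.eval a f = 0

end OmegaAlg

section Varieties

variable {k : Type u} [Field k] {Ω : Type v}

/-- A variety is the class of all algebras satisfying some set of identities. -/
def IsVariety (V : Set (OmegaAlg.{u, v, w} k Ω)) : Prop :=
  ∃ S : Set (OmegaPoly k Ω), V = {A | ∀ f ∈ S, A.Satisfies f}

/-- The ideal of identities of a class of algebras. -/
def identities (V : Set (OmegaAlg.{u, v, w} k Ω)) : Submodule k (OmegaPoly k Ω) where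
  carrier := {f | ∀ A ∈ V, A.Satisfies f}
  add_mem' := fun hf hg A hA a => by rw [map_add, hf A hA a, hg A hA a, add_zero]
  zero_mem' := fun A _ a => map_zero (A.eval a)
  smul_mem' := fun c f hf A hA a => by rw [map_smul, hf A hA a, smul_zero]

/-- `Var(C)`: the variety generated by a class `C` of algebras. -/
def generatedVariety (C : Set (OmegaAlg.{u, v, w} k Ω)) : Set (OmegaAlg.{u, v, w} k Ω) :=
  {A | ∀ f ∈ identities C, A.Satisfies f}

/-- The underlying space of the free algebra `V⟨x₀, x₁, …⟩` of a variety `V`. -/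
abbrev RelFree (V : Set (OmegaAlg.{u, v, w} k Ω)) : Type (max u v) :=
  OmegaPoly k Ω ⧸ identities V

/-- `V(n)`: the space of multilinear polynomials of degree `n` in `x₀, …, x_{n-1}`
in the free algebra of `V`. -/
noncomputable def multilinearPart (V : Set (OmegaAlg.{u, v, w} k Ω)) (n : ℕ) : Submodule k (RelFree V) :=
  (multilinearPoly k Ω n).map (identities V).mkQ

/-- The `n`th codimension `c_n(V) = dim V(n)`. It is finite when `Ω` is finite; for an infinite
family of operations it may be an infinite cardinal. -/
noncomputable def codim (V : Set (OmegaAlg.{u, v, w} k Ω)) (n : ℕ) : Cardinal.{max u v} :=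
  Module.rank k (multilinearPart V n)

end Varieties

/-- The doubled family of operation symbols `⊢_ω`, `⊣_ω`, `ω ∈ Ω`. -/
inductive DiOp (Ω : Type v) : Type v
  | vdash : Ω → DiOp Ω
  | dashv : Ω → DiOp Ω

/-- The class `di-Alg₀` of dialgebras satisfying the identities
`(x ⊢_ω y - x ⊣_ω y) ⊢_μ z = 0` and `x ⊣_μ (y ⊢_ω z - y ⊣_ω z) = 0`. -/
def diAlgZero (k : Type u) [Field k] (Ω : Type v) : Set (OmegaAlg.{u, v, w} k (DiOp Ω)) :=
  {D | ∀ (ω μ : Ω) (x y z : D.carrier),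
    D.op (.vdash μ) (D.op (.vdash ω) x y - D.op (.dashv ω) x y) z = 0 ∧
    D.op (.dashv μ) x (D.op (.vdash ω) y z - D.op (.dashv ω) y z) = 0}

/-- A pre-commutative (Zinbiel) algebra: a linear space with a bilinear product satisfying
`(x y + y x) z = x (y z)`. -/
structure PreComAlg (k : Type u) [Field k] where
  carrier : Type w
  [addCommGroup : AddCommGroup carrier]
  [module : Module k carrier]
  mul : carrier →ₗ[k] carrier →ₗ[k] carrier
  preCom : ∀ x y z : carrier, mul (mul x y + mul y x) z = mul x (mul y z)

attribute [instance] PreComAlg.addCommGroup PreComAlg.module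

/-- The algebra `Z ⊠ D`: the space `Z ⊗ D` with the operations
`(z ⊗ a) ∘_ω (w ⊗ b) = z w ⊗ (a ⊢_ω b) + w z ⊗ (a ⊣_ω b)`. -/
noncomputable def boxtimes {k : Type u} [Field k] {Ω : Type v} (Z : PreComAlg.{u, w} k)
    (D : OmegaAlg.{u, v, w} k (DiOp Ω)) : OmegaAlg.{u, v, w} k Ω where
  carrier := Z.carrier ⊗[k] D.carrier
  op ω := TensorProduct.map₂ Z.mul (D.op (.vdash ω)) +
    TensorProduct.map₂ Z.mul.flip (D.op (.dashv ω))

/-- The enveloping variety of a variety `V` of dialgebras: the variety generated by all algebras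
`Z ⊠ D` with `Z` pre-commutative and `D ∈ V`. -/
def envelopingVariety {k : Type u} [Field k] {Ω : Type v}
    (V : Set (OmegaAlg.{u, v, w} k (DiOp Ω))) : Set (OmegaAlg.{u, v, w} k Ω) :=
  generatedVariety {B | ∃ (Z : PreComAlg.{u, w} k), ∃ D ∈ V, B = boxtimes Z D}

/-- Polynomial growth: all terms are finite and `c n ≤ C n ^ d` for some constants `C`, `d`. -/
def PolynomialGrowth (c : ℕ → Cardinal.{w}) : Prop :=
  ∃ (C : ℝ) (d : ℕ), ∀ n : ℕ, 1 ≤ n →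
    c n < Cardinal.aleph0 ∧ ((c n).toNat : ℝ) ≤ C * (n : ℝ) ^ d

/-- Subexponential growth: all terms are finite and, for every `a > 1`, `c n ≤ C a ^ n` for some
constant `C`. -/
def SubexponentialGrowth (c : ℕ → Cardinal.{w}) : Prop :=
  ∀ a : ℝ, 1 < a → ∃ C : ℝ, ∀ n : ℕ, 1 ≤ n →
    c n < Cardinal.aleph0 ∧ ((c n).toNat : ℝ) ≤ C * a ^ n

/-- Intermediate growth: subexponential but not polynomial. -/
def IntermediateGrowth (c : ℕ → Cardinal.{w}) : Prop :=
  SubexponentialGrowth c ∧ ¬ PolynomialGrowth c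

/-! ### Words, underlying words and orientations -/

namespace OmegaWord

variable {Ω : Type v}

/-! In `di-Alg₀` a multilinear monomial is determined by its underlying word and its central
variable (`evalWord_eq_mark_center`). Hence, writing `fᵢ` for `f` with all operations pointing at
`xᵢ`, the `n` maps `f ↦ fᵢ` from `Alg(n)` together span `V(n)`.

On pure tensors a multilinear `f` takes the value `∑ᵢ (∏_{j ≠ i} z j) (z i) ⊗ fᵢ(a)`
(`eval_boxtimes`), the product being nested left multiplications, which commute. So `f` is an
identity of the enveloping variety as soon as all `fᵢ` are identities of `V`. The converse
(`satisfies_markPoly`) uses polynomials under `f · g = ∫ f g'`: at monomials of degrees `dᵢ` the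
`i`th coefficient becomes `dᵢ / ∑ dⱼ`, and varying one degree isolates `fᵢ`.

Thus `Alg(n) → V̂(n)` and `f ↦ (fᵢ)ᵢ` into `V(n)ⁿ` have the same kernel: `V̂(n)` embeds in `V(n)ⁿ`,
and `V̂(n)ⁿ` maps onto `V(n)`. A factor `n` affects neither kind of growth. -/

/-- The word obtained from a dialgebra word by identifying `⊢_ω` and `⊣_ω` with one operation. -/
def forget : OmegaWord (DiOp Ω) → OmegaWord Ω
  | .var i => .var i
  | .op (.vdash ω) s t => .op ω s.forget t.forget
  | .op (.dashv ω) s t => .op ω s.forget t.forget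

/-- The central variable of a dialgebra word: the one all operation symbols above it point at. -/
def center : OmegaWord (DiOp Ω) → ℕ
  | .var i => i
  | .op (.vdash _) _ t => t.center
  | .op (.dashv _) s _ => s.center

/-- Orient the operations of a word so that they point at the variable `xᵢ`. -/
def mark (i : ℕ) : OmegaWord Ω → OmegaWord (DiOp Ω)
  | .var j => .var j
  | .op ω s t =>
    if i ∈ t.vars then .op (.vdash ω) (s.mark i) (t.mark i)
    else .op (.dashv ω) (s.mark i) (t.mark i)

theorem vars_forget (p : OmegaWord (DiOp Ω)) : p.forget.vars = p.vars := by
  induction p with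
  | var i => rfl
  | op δ s t hs ht => cases δ <;> simp [forget, vars, hs, ht]

theorem center_mem_vars (p : OmegaWord (DiOp Ω)) : p.center ∈ p.vars := by
  induction p with
  | var i => simp [center, vars]
  | op δ s t hs ht => cases δ <;> simp [center, vars, hs, ht]

theorem forget_mark (i : ℕ) (t : OmegaWord Ω) : (t.mark i).forget = t := by
  induction t with
  | var j => rfl
  | op ω s t hs ht => simp only [mark]; split_ifs <;> simp [forget, hs, ht]

theorem vars_mark (i : ℕ) (t : OmegaWord Ω) : (t.mark i).vars = t.vars := by
  rw [← vars_forget, forget_mark]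

end OmegaWord

/-! ### Multilinear evaluation -/

namespace OmegaAlg

variable {k : Type u} [Field k] {Ω : Type v}

theorem evalWord_congr (A : OmegaAlg.{u, v, w} k Ω) {a b : ℕ → A.carrier} (t : OmegaWord Ω)
    (h : ∀ i ∈ t.vars, a i = b i) : A.evalWord a t = A.evalWord b t := by
  induction t with
  | var i => exact h i (by simp [OmegaWord.vars])
  | op ω s t hs ht =>
    simp only [evalWord]
    rw [hs fun i hi => h i (by simp [OmegaWord.vars, hi]),
      ht fun i hi => h i (by simp [OmegaWord.vars, hi])]

theorem evalWord_update_of_notMem (A : OmegaAlg.{u, v, w} k Ω) (a : ℕ → A.carrier) {i : ℕ}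
    (x : A.carrier) {t : OmegaWord Ω} (h : i ∉ t.vars) :
    A.evalWord (Function.update a i x) t = A.evalWord a t :=
  A.evalWord_congr t fun _ hj => Function.update_of_ne (ne_of_mem_of_not_mem hj h) _ _

/-- Words in which a variable occurs exactly once are additive in it. -/
theorem evalWord_update_add (A : OmegaAlg.{u, v, w} k Ω) (a : ℕ → A.carrier) {i : ℕ}
    (x y : A.carrier) {t : OmegaWord Ω} (hd : t.vars.Nodup) (hi : i ∈ t.vars) :
    A.evalWord (Function.update a i (x + y)) t =
      A.evalWord (Function.update a i x) t + A.evalWord (Function.update a i y) t := by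
  induction t with
  | var j =>
    obtain rfl : i = j := by simpa [OmegaWord.vars] using hi
    simp [evalWord]
  | op ω s t hs ht =>
    simp only [OmegaWord.vars, Multiset.nodup_add, Multiset.mem_add] at hd hi
    obtain ⟨hds, hdt, hdisj⟩ := hd
    simp only [evalWord]
    rcases hi with hi | hi
    · have hit : i ∉ t.vars := fun h => Multiset.disjoint_left.1 hdisj hi h
      simp only [A.evalWord_update_of_notMem a _ hit, hs hds hi, map_add, LinearMap.add_apply]
    · have his : i ∉ s.vars := fun h => Multiset.disjoint_left.1 hdisj h hi
      simp only [A.evalWord_update_of_notMem a _ his, ht hdt hi, map_add]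

theorem eval_eq_sum (A : OmegaAlg.{u, v, w} k Ω) (a : ℕ → A.carrier) (f : OmegaPoly k Ω) :
    A.eval a f = f.sum fun t c => c • A.evalWord a t :=
  Finsupp.linearCombination_apply _ _

theorem vars_of_mem_multilinearPoly {n : ℕ} {f : OmegaPoly k Ω} (hf : f ∈ multilinearPoly k Ω n)
    {t : OmegaWord Ω} (ht : t ∈ f.support) : t.vars = Multiset.range n :=
  (Finsupp.mem_supported k f).1 hf ht

theorem eval_congr_of_multilinear (A : OmegaAlg.{u, v, w} k Ω) {a b : ℕ → A.carrier} {n : ℕ}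
    {f : OmegaPoly k Ω} (hf : f ∈ multilinearPoly k Ω n) (h : ∀ i < n, a i = b i) :
    A.eval a f = A.eval b f := by
  rw [eval_eq_sum, eval_eq_sum]
  refine Finsupp.sum_congr fun t ht => ?_
  rw [A.evalWord_congr t fun i hi => h i ?_]
  rwa [vars_of_mem_multilinearPoly hf ht, Multiset.mem_range] at hi

theorem eval_update_add (A : OmegaAlg.{u, v, w} k Ω) (a : ℕ → A.carrier) {n : ℕ}
    {f : OmegaPoly k Ω} (hf : f ∈ multilinearPoly k Ω n) {i : ℕ} (hi : i < n) (x y : A.carrier) :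
    A.eval (Function.update a i (x + y)) f =
      A.eval (Function.update a i x) f + A.eval (Function.update a i y) f := by
  rw [eval_eq_sum, eval_eq_sum, eval_eq_sum, ← Finsupp.sum_add]
  refine Finsupp.sum_congr fun t ht => ?_
  have hv := vars_of_mem_multilinearPoly hf ht
  rw [A.evalWord_update_add a x y (hv ▸ Multiset.nodup_range n) (by simpa [hv] using hi), smul_add]

/-- A multilinear polynomial vanishing on a set of elements that spans additively is an identity. -/
theorem satisfies_of_multilinear (A : OmegaAlg.{u, v, w} k Ω) {n : ℕ}
    {f : OmegaPoly k Ω} (hf : f ∈ multilinearPoly k Ω n) (P : Set A.carrier) (hP₀ : 0 ∈ P)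
    (hP : AddSubmonoid.closure P = ⊤)
    (h : ∀ a : ℕ → A.carrier, (∀ i, a i ∈ P) → A.eval a f = 0) : A.Satisfies f := by
  -- The variables are freed one at a time: those below `m` are arbitrary, the others still lie in
  -- `P`.
  have key : ∀ m ≤ n, ∀ a : ℕ → A.carrier, (∀ i, m ≤ i → a i ∈ P) → A.eval a f = 0 := by
    intro m
    induction m with
    | zero => exact fun _ a ha => h a fun i => ha i i.zero_le
    | succ m ih =>
      intro hm a ha
      have hx : ∀ x : A.carrier, A.eval (Function.update a m x) f = 0 := by
        intro x
        have hx : x ∈ AddSubmonoid.closure P := hP ▸ AddSubmonoid.mem_top x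
        have mem : ∀ x ∈ P, A.eval (Function.update a m x) f = 0 := by
          intro x hx
          refine ih (by omega) _ fun i hi => ?_
          rcases hi.eq_or_lt with rfl | hi
          · simpa using hx
          · rw [Function.update_of_ne hi.ne']
            exact ha i hi
        induction hx using AddSubmonoid.closure_induction with
        | mem x hx => exact mem x hx
        | zero => exact mem 0 hP₀
        | add x y _ _ hx hy => rw [A.eval_update_add a hf (by omega), hx, hy, add_zero]
      simpa using hx (a m)
  intro a
  -- Variables outside `f` are reset to `0`, which lies in `P`, so that `key` applies with `m = n`.
  rw [A.eval_congr_of_multilinear hf (b := fun i => if i < n then a i else 0)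
    fun i hi => by simp [hi]]
  refine key n le_rfl _ fun i hi => ?_
  simpa [hi.not_gt] using hP₀

end OmegaAlg

/-! ### Normal form of multilinear monomials in `di-Alg₀` -/

section DiAlgZero

variable {k : Type u} [Field k] {Ω : Type v} {D : OmegaAlg.{u, v, w} k (DiOp Ω)}

open OmegaAlg OmegaWord

theorem vdash_op_congr (hD : D ∈ diAlgZero k Ω) (δ δ' : DiOp Ω) (ω μ : Ω)
    (hδ : δ = .vdash ω ∨ δ = .dashv ω) (hδ' : δ' = .vdash ω ∨ δ' = .dashv ω)
    (x y z : D.carrier) :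
    D.op (.vdash μ) (D.op δ x y) z = D.op (.vdash μ) (D.op δ' x y) z := by
  have h := (hD ω μ x y z).1
  rw [map_sub, LinearMap.sub_apply, sub_eq_zero] at h
  rcases hδ with rfl | rfl <;> rcases hδ' with rfl | rfl <;> simp [h]

theorem dashv_op_congr (hD : D ∈ diAlgZero k Ω) (δ δ' : DiOp Ω) (ω μ : Ω)
    (hδ : δ = .vdash ω ∨ δ = .dashv ω) (hδ' : δ' = .vdash ω ∨ δ' = .dashv ω)
    (x y z : D.carrier) :
    D.op (.dashv μ) z (D.op δ x y) = D.op (.dashv μ) z (D.op δ' x y) := by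
  have h := (hD ω μ z x y).2
  rw [map_sub, sub_eq_zero] at h
  rcases hδ with rfl | rfl <;> rcases hδ' with rfl | rfl <;> simp [h]

theorem OmegaWord.forget_eq_op {p : OmegaWord (DiOp Ω)} {ω : Ω} {s t : OmegaWord Ω}
    (h : p.forget = .op ω s t) :
    ∃ δ p₁ p₂, p = .op δ p₁ p₂ ∧ (δ = .vdash ω ∨ δ = .dashv ω) ∧
      p₁.forget = s ∧ p₂.forget = t := by
  match p, h with
  | .op (.vdash _) p₁ p₂, h =>
    cases h
    exact ⟨_, p₁, p₂, rfl, .inl rfl, rfl, rfl⟩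
  | .op (.dashv _) p₁ p₂, h =>
    cases h
    exact ⟨_, p₁, p₂, rfl, .inr rfl, rfl, rfl⟩

theorem OmegaWord.forget_eq_var {p : OmegaWord (DiOp Ω)} {i : ℕ} (h : p.forget = .var i) :
    p = .var i := by
  match p, h with
  | .var _, h => cases h; rfl
  | .op (.vdash _) _ _, h => cases h
  | .op (.dashv _) _ _, h => cases h

/-- The orientation of the operations in the non-central argument of an operation does not
matter. -/
theorem noncentral_congr (hD : D ∈ diAlgZero k Ω) (a : ℕ → D.carrier) (t : OmegaWord Ω) :
    ∀ (p q : OmegaWord (DiOp Ω)), p.forget = t → q.forget = t → ∀ (μ : Ω) (z : D.carrier),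
      D.op (.vdash μ) (D.evalWord a p) z = D.op (.vdash μ) (D.evalWord a q) z ∧
      D.op (.dashv μ) z (D.evalWord a p) = D.op (.dashv μ) z (D.evalWord a q) := by
  induction t with
  | var i =>
    intro p q hp hq μ z
    rw [forget_eq_var hp, forget_eq_var hq]
    exact ⟨rfl, rfl⟩
  | op ω s t hs ht =>
    intro p q hp hq μ z
    obtain ⟨δ, p₁, p₂, rfl, hδ, hp₁, hp₂⟩ := forget_eq_op hp
    obtain ⟨ε, q₁, q₂, rfl, hε, hq₁, hq₂⟩ := forget_eq_op hq
    simp only [evalWord]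
    constructor
    -- The inner symbol may be chosen freely. Taking `⊢` makes the first subword non-central and
    -- replaceable by induction; switching to `⊣` does the same for the second.
    · rw [vdash_op_congr hD δ (.vdash ω) ω μ hδ (.inl rfl),
        (hs p₁ q₁ hp₁ hq₁ ω _).1,
        vdash_op_congr hD (.vdash ω) (.dashv ω) ω μ (.inl rfl) (.inr rfl),
        (ht p₂ q₂ hp₂ hq₂ ω _).2,
        vdash_op_congr hD (.dashv ω) ε ω μ (.inr rfl) hε]
    · rw [dashv_op_congr hD δ (.vdash ω) ω μ hδ (.inl rfl),
        (hs p₁ q₁ hp₁ hq₁ ω _).1,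
        dashv_op_congr hD (.vdash ω) (.dashv ω) ω μ (.inl rfl) (.inr rfl),
        (ht p₂ q₂ hp₂ hq₂ ω _).2,
        dashv_op_congr hD (.dashv ω) ε ω μ (.inr rfl) hε]

/-- In `di-Alg₀` a multilinear word is determined by its underlying word and its center. -/
theorem evalWord_eq_mark_center (hD : D ∈ diAlgZero k Ω) (a : ℕ → D.carrier)
    (p : OmegaWord (DiOp Ω)) (hp : p.vars.Nodup) :
    D.evalWord a p = D.evalWord a (p.forget.mark p.center) := by
  induction p with
  | var i => rfl
  | op δ s t hs ht =>
    simp only [OmegaWord.vars, Multiset.nodup_add] at hp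
    obtain ⟨hds, hdt, hdisj⟩ := hp
    cases δ with
    | vdash ω =>
      have hc : t.center ∈ t.forget.vars := vars_forget t ▸ t.center_mem_vars
      simp only [forget, center, mark, if_pos hc, evalWord]
      rw [← ht hdt]
      exact (noncentral_congr hD a s.forget s _ rfl (forget_mark _ _) ω _).1
    | dashv ω =>
      -- `mark` inspects only the right argument, so linearity of the word is needed to exclude the
      -- center of `s` from `t`.
      have hc : s.center ∉ t.forget.vars := fun h =>
        Multiset.disjoint_left.1 hdisj s.center_mem_vars (vars_forget t ▸ h)
      simp only [forget, center, mark, if_neg hc, evalWord]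
      rw [← hs hds]
      exact (noncentral_congr hD a t.forget t _ rfl (forget_mark _ _) ω _).2

end DiAlgZero

/-! ### Left multiplications in pre-commutative algebras -/

namespace PreComAlg

variable {k : Type u} [Field k] (Z : PreComAlg.{u, w} k)

theorem mul_left_comm (x y z : Z.carrier) : Z.mul x (Z.mul y z) = Z.mul y (Z.mul x z) := by
  rw [← Z.preCom, ← Z.preCom, add_comm]

instance leftCommutative_mul (z : ℕ → Z.carrier) :
    LeftCommutative fun (i : ℕ) (x : Z.carrier) => Z.mul (z i) x :=
  ⟨fun i j x => Z.mul_left_comm (z i) (z j) x⟩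

/-- The composition of the commuting operators of left multiplication by `z i`, `i ∈ m`. -/
def leftMul (z : ℕ → Z.carrier) (m : Multiset ℕ) (x : Z.carrier) : Z.carrier :=
  m.foldr (fun i x => Z.mul (z i) x) x

theorem leftMul_add (z : ℕ → Z.carrier) (m m' : Multiset ℕ) (x : Z.carrier) :
    Z.leftMul z (m + m') x = Z.leftMul z m (Z.leftMul z m' x) :=
  Multiset.foldr_add _ _ _ _

/-- The product `(∏_{j ∈ m, j ≠ i} z j) (z i)`. -/
def tailProd (z : ℕ → Z.carrier) (m : Multiset ℕ) (i : ℕ) : Z.carrier :=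
  Z.leftMul z (m.erase i) (z i)

theorem tailProd_add_left (z : ℕ → Z.carrier) (m m' : Multiset ℕ) {i : ℕ} (hi : i ∈ m) :
    Z.tailProd z (m + m') i = Z.leftMul z m' (Z.tailProd z m i) := by
  rw [tailProd, Multiset.erase_add_left_pos _ hi, add_comm, leftMul_add, tailProd]

theorem tailProd_add_right (z : ℕ → Z.carrier) (m m' : Multiset ℕ) {i : ℕ} (hi : i ∈ m') :
    Z.tailProd z (m + m') i = Z.leftMul z m (Z.tailProd z m' i) := by
  rw [add_comm, tailProd_add_left _ _ _ _ hi]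

/-- Left multiplication by `∑_{i ∈ m} (∏_{j ∈ m, j ≠ i} z j) (z i)`, the product of all `z i`
under `x * y = x y + y x`. -/
theorem mul_sum_tailProd {Ω : Type v} (z : ℕ → Z.carrier) (t : OmegaWord Ω) (x : Z.carrier) :
    Z.mul (t.vars.map (Z.tailProd z t.vars)).sum x = Z.leftMul z t.vars x := by
  induction t generalizing x with
  | var i => simp [OmegaWord.vars, tailProd, leftMul]
  | op ω s t hs ht =>
    -- For `i` in `s`, the variables of `t` only contribute left multiplications; by induction these
    -- amount to one multiplication by the sum belonging to `t`.
    have hL : (s.vars.map (Z.tailProd z (s.vars + t.vars))).sum =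
        Z.mul (t.vars.map (Z.tailProd z t.vars)).sum (s.vars.map (Z.tailProd z s.vars)).sum := by
      rw [map_multiset_sum, Multiset.map_map]
      refine congrArg _ (Multiset.map_congr rfl fun i hi => ?_)
      rw [Function.comp_apply, tailProd_add_left _ _ _ _ hi, ht]
    have hR : (t.vars.map (Z.tailProd z (s.vars + t.vars))).sum =
        Z.mul (s.vars.map (Z.tailProd z s.vars)).sum (t.vars.map (Z.tailProd z t.vars)).sum := by
      rw [map_multiset_sum, Multiset.map_map]
      refine congrArg _ (Multiset.map_congr rfl fun i hi => ?_)
      rw [Function.comp_apply, tailProd_add_right _ _ _ _ hi, hs]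
    rw [OmegaWord.vars, Multiset.map_add, Multiset.sum_add, hL, hR, add_comm, Z.preCom, leftMul_add,
      hs, ht]

end PreComAlg

/-! ### Evaluation in `Z ⊠ D` -/

section Boxtimes

variable {k : Type u} [Field k] {Ω : Type v} (Z : PreComAlg.{u, w} k)
  {D : OmegaAlg.{u, v, w} k (DiOp Ω)}

/-- The identification of the space of `Z ⊠ D` with the tensor product. -/
noncomputable def boxTensor (D : OmegaAlg.{u, v, w} k (DiOp Ω)) :
    Z.carrier ⊗[k] D.carrier ≃ₗ[k] (boxtimes Z D).carrier :=
  LinearEquiv.refl k _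

theorem boxtimes_op (D : OmegaAlg.{u, v, w} k (DiOp Ω)) (ω : Ω)
    (x y : Z.carrier ⊗[k] D.carrier) :
    (boxtimes Z D).op ω (boxTensor Z D x) (boxTensor Z D y) =
      boxTensor Z D (TensorProduct.map₂ Z.mul (D.op (.vdash ω)) x y +
        TensorProduct.map₂ Z.mul.flip (D.op (.dashv ω)) x y) := rfl

section Map₂

variable {ι κ : Type*} {M₁ M₂ M N₁ N₂ N : Type*} [AddCommGroup M₁] [AddCommGroup M₂]
  [AddCommGroup M] [AddCommGroup N₁] [AddCommGroup N₂] [AddCommGroup N] [Module k M₁] [Module k M₂]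
  [Module k M] [Module k N₁] [Module k N₂] [Module k N]
  (f : M₁ →ₗ[k] M₂ →ₗ[k] M) (g : N₁ →ₗ[k] N₂ →ₗ[k] N)

/-- When the `N`-component ignores the left index, the left factors add up. This produces the sum
that `mul_sum_tailProd` turns into left multiplications. -/
theorem map₂_sum_tmul_of_left_const (m : Multiset ι) (m' : Multiset κ) (p : ι → M₁) (q : κ → M₂)
    (a : ι → N₁) (b : κ → N₂) (c : κ → N) (h : ∀ i j, g (a i) (b j) = c j) :
    TensorProduct.map₂ f g (m.map fun i => p i ⊗ₜ[k] a i).sum (m'.map fun j => q j ⊗ₜ[k] b j).sum =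
      (m'.map fun j => f (m.map p).sum (q j) ⊗ₜ[k] c j).sum := by
  induction m' using Multiset.induction_on with
  | empty => simp
  | cons j m' ih =>
    simp only [Multiset.map_cons, Multiset.sum_cons, map_add, ih, add_left_inj]
    clear ih
    induction m using Multiset.induction_on with
    | empty => simp
    | cons i m ih => simp [ih, h, TensorProduct.add_tmul]

theorem map₂_sum_tmul_of_right_const (m : Multiset ι) (m' : Multiset κ) (p : ι → M₁) (q : κ → M₂)
    (a : ι → N₁) (b : κ → N₂) (c : ι → N) (h : ∀ i j, g (a i) (b j) = c i) :
    TensorProduct.map₂ f g (m.map fun i => p i ⊗ₜ[k] a i).sum (m'.map fun j => q j ⊗ₜ[k] b j).sum =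
      (m.map fun i => f (p i) (m'.map q).sum ⊗ₜ[k] c i).sum := by
  induction m using Multiset.induction_on with
  | empty => simp
  | cons i m ih =>
    simp only [Multiset.map_cons, Multiset.sum_cons, map_add, LinearMap.add_apply, ih,
      add_left_inj, TensorProduct.map₂_apply_tmul]
    clear ih
    induction m' using Multiset.induction_on with
    | empty => simp
    | cons j m' ih => simp [ih, h, TensorProduct.add_tmul]

end Map₂

/-- The value of a multilinear word on pure tensors. -/
theorem evalWord_boxtimes (hD : D ∈ diAlgZero k Ω) (z : ℕ → Z.carrier) (a : ℕ → D.carrier)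
    (t : OmegaWord Ω) (ht : t.vars.Nodup) :
    (boxtimes Z D).evalWord (fun i => boxTensor Z D (z i ⊗ₜ[k] a i)) t = boxTensor Z D
      (t.vars.map fun i => Z.tailProd z t.vars i ⊗ₜ[k] D.evalWord a (t.mark i)).sum := by
  induction t with
  | var i =>
    simp [OmegaWord.vars, OmegaAlg.evalWord, PreComAlg.tailProd, PreComAlg.leftMul, OmegaWord.mark]
  | op ω s t hs ht' =>
    simp only [OmegaWord.vars, Multiset.nodup_add] at ht
    obtain ⟨hds, hdt, hdisj⟩ := ht
    -- `⊢` keeps the center in `t`. By `noncentral_congr` the orientation of `s` is immaterial, so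
    -- `s` can be marked at the same variable as `t`.
    have h₁ := map₂_sum_tmul_of_left_const Z.mul (D.op (.vdash ω)) s.vars t.vars
      (Z.tailProd z s.vars) (Z.tailProd z t.vars) (fun i => D.evalWord a (s.mark i))
      (fun j => D.evalWord a (t.mark j))
      (fun j => D.op (.vdash ω) (D.evalWord a (s.mark j)) (D.evalWord a (t.mark j)))
      fun i j => (noncentral_congr hD a s _ _ (OmegaWord.forget_mark i s)
        (OmegaWord.forget_mark j s) ω _).1
    have h₂ := map₂_sum_tmul_of_right_const Z.mul.flip (D.op (.dashv ω)) s.vars t.vars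
      (Z.tailProd z s.vars) (Z.tailProd z t.vars) (fun i => D.evalWord a (s.mark i))
      (fun j => D.evalWord a (t.mark j))
      (fun i => D.op (.dashv ω) (D.evalWord a (s.mark i)) (D.evalWord a (t.mark i)))
      fun i j => (noncentral_congr hD a t _ _ (OmegaWord.forget_mark j t)
        (OmegaWord.forget_mark i t) ω _).2
    rw [OmegaAlg.evalWord, hs hds, ht' hdt, boxtimes_op, h₁, h₂, OmegaWord.vars, Multiset.map_add,
      Multiset.sum_add, add_comm]
    refine congrArg _ (congrArg₂ (· + ·) ?_ ?_)
    · refine congrArg _ (Multiset.map_congr rfl fun i hi => ?_)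
      have hit : i ∉ t.vars := fun h => Multiset.disjoint_left.1 hdisj hi h
      rw [LinearMap.flip_apply, Z.mul_sum_tailProd, Z.tailProd_add_left _ _ _ hi]
      simp only [OmegaWord.mark, if_neg hit, OmegaAlg.evalWord]
    · refine congrArg _ (Multiset.map_congr rfl fun j hj => ?_)
      rw [Z.mul_sum_tailProd, Z.tailProd_add_right _ _ _ hj]
      simp only [OmegaWord.mark, if_pos hj, OmegaAlg.evalWord]

/-- Orient all operations of a polynomial so that they point at the variable `xᵢ`. -/
noncomputable def markPoly (k : Type u) [Field k] (Ω : Type v) (i : ℕ) :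
    OmegaPoly k Ω →ₗ[k] OmegaPoly k (DiOp Ω) :=
  Finsupp.lmapDomain k k (OmegaWord.mark i)

theorem eval_markPoly (D : OmegaAlg.{u, v, w} k (DiOp Ω)) (a : ℕ → D.carrier) (i : ℕ)
    (f : OmegaPoly k Ω) :
    D.eval a (markPoly k Ω i f) = f.sum fun t c => c • D.evalWord a (t.mark i) := by
  rw [OmegaAlg.eval, markPoly, Finsupp.lmapDomain_apply, Finsupp.linearCombination_mapDomain,
    Finsupp.linearCombination_apply]
  rfl

theorem markPoly_mem_multilinearPoly {n : ℕ} (i : ℕ) {f : OmegaPoly k Ω}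
    (hf : f ∈ multilinearPoly k Ω n) : markPoly k Ω i f ∈ multilinearPoly k (DiOp Ω) n := by
  classical
  refine (Finsupp.mem_supported k _).2 fun p hp => ?_
  obtain ⟨t, ht, rfl⟩ := Finset.mem_image.1 (Finsupp.mapDomain_support hp)
  exact (OmegaWord.vars_mark i t).trans (OmegaAlg.vars_of_mem_multilinearPoly hf ht)

/-- The value of a multilinear polynomial on pure tensors. -/
theorem eval_boxtimes (hD : D ∈ diAlgZero k Ω) (z : ℕ → Z.carrier) (a : ℕ → D.carrier) {n : ℕ}
    {f : OmegaPoly k Ω} (hf : f ∈ multilinearPoly k Ω n) :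
    (boxtimes Z D).eval (fun i => boxTensor Z D (z i ⊗ₜ[k] a i)) f =
      boxTensor Z D (∑ i ∈ Finset.range n,
        Z.tailProd z (Multiset.range n) i ⊗ₜ[k] D.eval a (markPoly k Ω i f)) := by
  rw [OmegaAlg.eval_eq_sum]
  simp only [eval_markPoly, Finsupp.sum, TensorProduct.tmul_sum]
  rw [Finset.sum_comm, map_sum]
  refine Finset.sum_congr rfl fun t ht => ?_
  have hv := OmegaAlg.vars_of_mem_multilinearPoly hf ht
  rw [evalWord_boxtimes Z hD z a t (hv ▸ Multiset.nodup_range n), hv, ← map_smul]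
  simp only [TensorProduct.tmul_smul]
  exact congrArg _ (Finset.smul_sum (s := Finset.range n))

end Boxtimes

/-! ### Separating the orientations by an integral algebra -/

section Kernel

variable {k : Type u} [Field k] {Ω : Type v}

/-- The polynomials without constant term under `f · g = ∫ f g'`, that is
`tᵃ · tᵇ = b / (a + b) tᵃ⁺ᵇ`. -/
noncomputable def integralMul (k : Type u) [Field k] :
    (ULift.{v} ℕ+ →₀ k) →ₗ[k] (ULift.{v} ℕ+ →₀ k) →ₗ[k] (ULift.{v} ℕ+ →₀ k) :=
  Finsupp.lift _ k _ fun a => Finsupp.lift _ k _ fun b =>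
    Finsupp.single ⟨a.down + b.down⟩ (((b.down : ℕ) : k) / ((a.down : ℕ) + (b.down : ℕ)))

theorem integralMul_single (a b : ULift.{v} ℕ+) (c d : k) :
    integralMul k (Finsupp.single a c) (Finsupp.single b d) =
      Finsupp.single ⟨a.down + b.down⟩
        (c * d * (((b.down : ℕ) : k) / ((a.down : ℕ) + (b.down : ℕ)))) := by
  simp [integralMul, -Finsupp.single_mul, mul_assoc]

/-- Integration by parts: without constant terms `∫ x y' + ∫ y x'` is the ordinary product, so both
sides are `∫ x y z'`. The check is made on monomials. -/
theorem integralMul_preCom [CharZero k] (x y z : ULift.{v} ℕ+ →₀ k) :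
    integralMul k (integralMul k x y + integralMul k y x) z =
      integralMul k x (integralMul k y z) := by
  induction x using Finsupp.induction_linear with
  | zero => simp
  | add x x' hx hx' =>
    simp only [map_add, LinearMap.add_apply] at hx hx' ⊢
    rw [← hx, ← hx']
    abel
  | single a c =>
  induction y using Finsupp.induction_linear with
  | zero => simp
  | add x x' hx hx' =>
    simp only [map_add, LinearMap.add_apply] at hx hx' ⊢
    rw [← hx, ← hx']
    abel
  | single b d =>
  induction z using Finsupp.induction_linear with
  | zero => simp
  | add x x' hx hx' => rw [map_add, hx, hx', map_add, map_add]
  | single e g =>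
    obtain ⟨a⟩ := a
    obtain ⟨b⟩ := b
    obtain ⟨e⟩ := e
    simp only [integralMul_single, add_comm b a, ← add_assoc, ← Finsupp.single_add]
    congr 1
    have ha : ((a : ℕ) : k) ≠ 0 := by exact_mod_cast a.ne_zero
    have h₁ : ((a : ℕ) : k) + (b : ℕ) ≠ 0 := by exact_mod_cast (a + b).ne_zero
    have h₁' : ((b : ℕ) : k) + (a : ℕ) ≠ 0 := by exact_mod_cast (b + a).ne_zero
    have h₂ : ((b : ℕ) : k) + (e : ℕ) ≠ 0 := by exact_mod_cast (b + e).ne_zero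
    have h₃ : ((a : ℕ) : k) + (b : ℕ) + (e : ℕ) ≠ 0 := by exact_mod_cast (a + b + e).ne_zero
    have h₄ : ((a : ℕ) : k) + ((b : ℕ) + (e : ℕ)) ≠ 0 := by rwa [← add_assoc]
    push_cast
    field_simp
    ring

/-- The pre-commutative algebra of polynomials without constant term. -/
noncomputable def integralPreCom (k : Type u) [Field k] [CharZero k] :
    PreComAlg.{u, max u v} k where
  carrier := ULift.{v} ℕ+ →₀ k
  mul := integralMul k
  preCom := integralMul_preCom

/-- The monomial `tᵈ`. -/
noncomputable def monomialPow (k : Type u) [Field k] [CharZero k] (d : ℕ+) :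
    (integralPreCom.{u, v} k).carrier :=
  (Finsupp.single ⟨d⟩ 1 : ULift.{v} ℕ+ →₀ k)

/-- The functional summing up the coefficients. -/
noncomputable def coeffSum (k : Type u) [Field k] [CharZero k] :
    (integralPreCom.{u, v} k).carrier →ₗ[k] k :=
  Finsupp.lsum k fun _ : ULift.{v} ℕ+ => LinearMap.id

/-- Multiplying `t^N` by `t^d` on the left gives the coefficient `N / (d + N)`; these telescope. -/
theorem leftMul_monomialPow [CharZero k] (d : ℕ → ℕ+) (m : Multiset ℕ) (e : ℕ+) :
    ∃ N : ℕ+, (N : ℕ) = (m.map fun i => (d i : ℕ)).sum + e ∧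
      (integralPreCom.{u, v} k).leftMul (fun i => monomialPow k (d i)) m (monomialPow k e) =
        ((e : ℕ) / (N : ℕ) : k) • monomialPow k N := by
  induction m using Multiset.induction_on with
  | empty =>
    refine ⟨e, by simp, ?_⟩
    rw [div_self (by exact_mod_cast e.ne_zero), one_smul]
    simp [PreComAlg.leftMul]
  | cons i m ih =>
    obtain ⟨N, hN, h⟩ := ih
    refine ⟨d i + N, by simp [hN, add_assoc], ?_⟩
    have : (integralPreCom.{u, v} k).leftMul (fun i => monomialPow k (d i)) (i ::ₘ m)
        (monomialPow k e) = (integralPreCom.{u, v} k).mul (monomialPow k (d i))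
          ((integralPreCom.{u, v} k).leftMul (fun i => monomialPow k (d i)) m (monomialPow k e)) :=
      Multiset.foldr_cons _ _ _ _
    rw [this, h, map_smul]
    have hmul : (integralPreCom.{u, v} k).mul (monomialPow k (d i)) (monomialPow k N) =
        (((N : ℕ) : k) / ((d i : ℕ) + (N : ℕ))) • monomialPow k (d i + N) := by
      refine (integralMul_single (k := k) ⟨d i⟩ ⟨N⟩ 1 1).trans ?_
      refine Eq.trans ?_ (Finsupp.smul_single _ _ _).symm
      simp
    have hN₀ : ((N : ℕ) : k) ≠ 0 := by exact_mod_cast N.ne_zero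
    rw [hmul, smul_smul]
    congr 1
    push_cast
    field_simp

theorem coeffSum_tailProd [CharZero k] (d : ℕ → ℕ+) {n i : ℕ} (hi : i < n) :
    coeffSum.{u, v} k
      ((integralPreCom.{u, v} k).tailProd (fun i => monomialPow k (d i)) (Multiset.range n) i) =
        ((d i : ℕ) : k) / (∑ j ∈ Finset.range n, (d j : ℕ) : ℕ) := by
  obtain ⟨N, hN, h⟩ := leftMul_monomialPow.{u, v} (k := k) d ((Multiset.range n).erase i) (d i)
  have hN' : (N : ℕ) = ∑ j ∈ Finset.range n, (d j : ℕ) := by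
    rw [hN, add_comm]
    exact Multiset.sum_map_erase (f := fun i => (d i : ℕ)) (Multiset.mem_range.2 hi)
  rw [PreComAlg.tailProd, h, map_smul, ← hN']
  have : coeffSum.{u, v} k (monomialPow k N) = 1 := by
    refine (Finsupp.lsum_single _ _ _ _).trans ?_
    simp
  rw [this, smul_eq_mul, mul_one]

theorem identities_generatedVariety (C : Set (OmegaAlg.{u, v, w} k Ω)) :
    identities (generatedVariety C) = identities C :=
  le_antisymm (fun _ hf A hA => hf A fun _ hg => hg A hA) fun f hf _ hA => hA f hf

theorem satisfies_boxtimes {D : OmegaAlg.{u, v, w} k (DiOp Ω)} (Z : PreComAlg.{u, w} k)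
    (hD : D ∈ diAlgZero k Ω) {n : ℕ} {f : OmegaPoly k Ω} (hf : f ∈ multilinearPoly k Ω n)
    (h : ∀ i < n, D.Satisfies (markPoly k Ω i f)) : (boxtimes Z D).Satisfies f := by
  refine OmegaAlg.satisfies_of_multilinear _ hf
    {x | ∃ (z : Z.carrier) (a : D.carrier), boxTensor Z D (z ⊗ₜ[k] a) = x}
    ⟨0, 0, by simp⟩ ?_ fun a ha => ?_
  · refine (AddSubmonoid.eq_top_iff' _).2 fun x => ?_
    obtain ⟨x, rfl⟩ := (boxTensor Z D).surjective x
    induction x using TensorProduct.induction_on with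
    | zero => rw [map_zero]; exact zero_mem _
    | tmul z a => exact AddSubmonoid.subset_closure ⟨z, a, rfl⟩
    | add x y hx hy => rw [map_add]; exact add_mem hx hy
  · choose z b hzb using ha
    obtain rfl := funext hzb
    rw [eval_boxtimes Z hD z b hf, Finset.sum_eq_zero, map_zero]
    intro i hi
    rw [h i (Finset.mem_range.1 hi) b, TensorProduct.tmul_zero]

/-- Applying `coeffSum` to the first tensor factor turns `eval_boxtimes` into a linear relation
among the values of the orientations, with weights governed by the chosen degrees. -/
theorem satisfies_markPoly [CharZero k] {D : OmegaAlg.{u, v, max u v} k (DiOp Ω)}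
    (hD : D ∈ diAlgZero k Ω) {n : ℕ} {f : OmegaPoly k Ω} (hf : f ∈ multilinearPoly k Ω n)
    (h : (boxtimes (integralPreCom.{u, v} k) D).Satisfies f) {i : ℕ} (hi : i < n) :
    D.Satisfies (markPoly k Ω i f) := by
  intro a
  have key : ∀ d : ℕ → ℕ+,
      ∑ j ∈ Finset.range n, ((d j : ℕ) : k) • D.eval a (markPoly k Ω j f) = 0 := by
    intro d
    have h₀ := h fun i => boxTensor _ D (monomialPow k (d i) ⊗ₜ[k] a i)
    rw [eval_boxtimes _ hD _ a hf, LinearEquiv.map_eq_zero_iff] at h₀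
    have h₁ := congrArg (fun x => TensorProduct.lid k D.carrier
      (LinearMap.rTensor D.carrier (coeffSum.{u, v} k) x)) h₀
    simp only [map_sum, LinearMap.rTensor_tmul, TensorProduct.lid_tmul, map_zero] at h₁
    have hN : ((∑ j ∈ Finset.range n, (d j : ℕ) : ℕ) : k) ≠ 0 := by
      have := Finset.single_le_sum (f := fun j => (d j : ℕ)) (fun _ _ => Nat.zero_le _)
        (Finset.mem_range.2 hi)
      exact_mod_cast ((d i).pos.trans_le this).ne'
    -- The common denominator `∑ dⱼ` of the weights is cleared.
    rw [← smul_right_injective _ (inv_ne_zero hN) |>.eq_iff, smul_zero, ← h₁, Finset.smul_sum]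
    refine Finset.sum_congr rfl fun j hj => ?_
    rw [coeffSum_tailProd d (Finset.mem_range.1 hj), smul_smul, div_eq_inv_mul]
  -- The two degree choices differ by one at `i` and agree elsewhere, so subtracting the relations
  -- leaves the `i`th value alone.
  have h₁ := key fun _ => 1
  have h₂ := key fun j => if j = i then 2 else 1
  rw [← sub_eq_zero.2 (h₂.trans h₁.symm), ← Finset.sum_sub_distrib]
  rw [Finset.sum_eq_single_of_mem i (Finset.mem_range.2 hi)]
  · rw [← sub_smul]
    norm_num
  · intro j _ hj
    simp [hj]

/-- A multilinear polynomial is an identity of the enveloping variety if and only if all its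
orientations are identities of `V`. -/
theorem mem_identities_envelopingVariety [CharZero k]
    {V : Set (OmegaAlg.{u, v, max u v} k (DiOp Ω))} (hV₀ : V ⊆ diAlgZero k Ω) {n : ℕ}
    {f : OmegaPoly k Ω} (hf : f ∈ multilinearPoly k Ω n) :
    f ∈ identities (envelopingVariety V) ↔ ∀ i < n, markPoly k Ω i f ∈ identities V := by
  rw [envelopingVariety, identities_generatedVariety]
  constructor
  · exact fun h i hi D hD => satisfies_markPoly (hV₀ hD) hf (h _ ⟨_, D, hD, rfl⟩) hi
  · rintro h _ ⟨Z, D, hD, rfl⟩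
    exact satisfies_boxtimes Z (hV₀ hD) hf fun i hi => h i hi D hD

end Kernel

/-! ### Rank comparison from kernels -/

section Rank

variable {k : Type u} [Field k] {M N P : Type v} [AddCommGroup M] [AddCommGroup N] [AddCommGroup P]
  [Module k M] [Module k N] [Module k P] {n : ℕ}

/-- `N` is `M` modulo the common kernel, hence embeds in `Pⁿ`. -/
theorem rank_le_mul_of_ker_eq_ker_pi (ψ : M →ₗ[k] N) (hψ : Function.Surjective ψ)
    (φ : Fin n → M →ₗ[k] P) (h : LinearMap.ker ψ = LinearMap.ker (LinearMap.pi φ)) :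
    Module.rank k N ≤ n * Module.rank k P := by
  have e₁ := ψ.quotKerEquivOfSurjective hψ
  have e₂ := (LinearMap.pi φ).quotKerEquivRange
  rw [← h] at e₂
  calc Module.rank k N = _ := (e₁.symm.trans e₂).rank_eq
    _ ≤ Module.rank k (Fin n → P) := Submodule.rank_le _
    _ = n * Module.rank k P := by simp

/-- Each `φ i` factors through `N`; by `hφ` the sum of the induced maps sends `Nⁿ` onto `P`. -/
theorem rank_le_mul_of_ker_le_ker (ψ : M →ₗ[k] N) (hψ : Function.Surjective ψ)
    (φ : Fin n → M →ₗ[k] P) (h : ∀ i, LinearMap.ker ψ ≤ LinearMap.ker (φ i))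
    (hφ : ∀ x, ∃ g : Fin n → M, ∑ i, φ i (g i) = x) :
    Module.rank k P ≤ n * Module.rank k N := by
  let Φ : (Fin n → M ⧸ LinearMap.ker ψ) →ₗ[k] P :=
    ∑ i, (LinearMap.ker ψ).liftQ (φ i) (h i) ∘ₗ LinearMap.proj i
  have hΦ : Function.Surjective Φ := by
    intro x
    obtain ⟨g, rfl⟩ := hφ x
    exact ⟨fun i => (LinearMap.ker ψ).mkQ (g i), by simp [Φ]⟩
  calc Module.rank k P ≤ Module.rank k (Fin n → M ⧸ LinearMap.ker ψ) :=
        Φ.rank_le_of_surjective hΦ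
    _ = n * Module.rank k N := by
      simp [(ψ.quotKerEquivOfSurjective hψ).rank_eq]

end Rank

/-! ### The two codimension inequalities -/

section Codimension

variable {k : Type u} [Field k] {Ω : Type v} (V : Set (OmegaAlg.{u, v, max u v} k (DiOp Ω)))

/-- The class of a multilinear polynomial in the relatively free algebra. -/
noncomputable def multilinearMk (W : Set (OmegaAlg.{u, v, w} k Ω)) (n : ℕ) :
    multilinearPoly k Ω n →ₗ[k] multilinearPart W n :=
  ((identities W).mkQ.domRestrict _).codRestrict _ fun f => Submodule.mem_map_of_mem f.2

theorem multilinearMk_surjective (W : Set (OmegaAlg.{u, v, w} k Ω)) (n : ℕ) :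
    Function.Surjective (multilinearMk W n) := by
  rintro ⟨_, f, hf, rfl⟩
  exact ⟨⟨f, hf⟩, rfl⟩

theorem multilinearMk_eq_zero (W : Set (OmegaAlg.{u, v, w} k Ω)) {n : ℕ}
    (f : multilinearPoly k Ω n) : multilinearMk W n f = 0 ↔ (f : OmegaPoly k Ω) ∈ identities W := by
  rw [← Submodule.Quotient.mk_eq_zero, Subtype.ext_iff]
  rfl

/-- Orientation of multilinear polynomials towards `xᵢ`, with values in the relatively free
dialgebra. -/
noncomputable def markMk (n i : ℕ) : multilinearPoly k Ω n →ₗ[k] multilinearPart V n :=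
  multilinearMk V n ∘ₗ (markPoly k Ω i).restrict fun _ => markPoly_mem_multilinearPoly i

theorem markMk_eq_zero {n i : ℕ} (f : multilinearPoly k Ω n) :
    markMk V n i f = 0 ↔ markPoly k Ω i f ∈ identities V :=
  multilinearMk_eq_zero V _

theorem ker_multilinearMk_envelopingVariety [CharZero k] (hV₀ : V ⊆ diAlgZero k Ω) (n : ℕ) :
    LinearMap.ker (multilinearMk (envelopingVariety V) n) =
      LinearMap.ker (LinearMap.pi fun i : Fin n => markMk V n i) := by
  ext f
  rw [LinearMap.mem_ker, LinearMap.mem_ker, multilinearMk_eq_zero,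
    mem_identities_envelopingVariety hV₀ f.2]
  simp [funext_iff, markMk_eq_zero, Fin.forall_iff]

theorem codim_envelopingVariety_le [CharZero k] (hV₀ : V ⊆ diAlgZero k Ω) (n : ℕ) :
    codim (envelopingVariety V) n ≤ n * codim V n := by
  have h := rank_le_mul_of_ker_eq_ker_pi.{u, max u v} (M := multilinearPoly k Ω n)
    (N := multilinearPart (envelopingVariety V) n) (P := multilinearPart V n)
    (multilinearMk (envelopingVariety V) n)
    (multilinearMk_surjective _ n) (fun i : Fin n => markMk V n i)
    (ker_multilinearMk_envelopingVariety V hV₀ n)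
  exact h

theorem mkQ_single_eq_markPoly (hV₀ : V ⊆ diAlgZero k Ω) {p : OmegaWord (DiOp Ω)}
    (hp : p.vars.Nodup) :
    (identities V).mkQ (Finsupp.single p 1) =
      (identities V).mkQ (markPoly k Ω p.center (Finsupp.single p.forget 1)) := by
  rw [← sub_eq_zero, ← map_sub, Submodule.mkQ_apply, Submodule.Quotient.mk_eq_zero]
  intro D hD a
  rw [map_sub, eval_markPoly, OmegaAlg.eval_eq_sum, Finsupp.sum_single_index (by simp),
    Finsupp.sum_single_index (by simp), evalWord_eq_mark_center (hV₀ hD) a p hp, sub_self]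

/-- A monomial with center `x_c` is, modulo identities, the orientation of its underlying word
towards `x_c`, and monomials span. -/
theorem exists_sum_markMk (hV₀ : V ⊆ diAlgZero k Ω) (n : ℕ) (x : multilinearPart V n) :
    ∃ g : Fin n → multilinearPoly k Ω n, ∑ i : Fin n, markMk V n i (g i) = x := by
  let Ψ : (Fin n → multilinearPoly k Ω n) →ₗ[k] multilinearPart V n :=
    LinearMap.lsum k _ k fun i => markMk V n i
  have h : multilinearPoly k (DiOp Ω) n ≤
      ((LinearMap.range Ψ).map (multilinearPart V n).subtype).comap (identities V).mkQ := by
    rw [multilinearPoly, Finsupp.supported_eq_span_single, Submodule.span_le]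
    rintro _ ⟨p, hp : p.vars = Multiset.range n, rfl⟩
    have hc : p.center < n := by
      rw [← Multiset.mem_range, ← hp]
      exact p.center_mem_vars
    have hf : (Finsupp.single p.forget 1 : OmegaPoly k Ω) ∈ multilinearPoly k Ω n :=
      Finsupp.single_mem_supported k _ ((OmegaWord.vars_forget p).trans hp)
    refine ⟨markMk V n p.center ⟨_, hf⟩, ⟨Pi.single ⟨p.center, hc⟩ ⟨_, hf⟩, ?_⟩, ?_⟩
    · exact LinearMap.lsum_piSingle k _ k (fun i : Fin n => markMk V n i) ⟨p.center, hc⟩ _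
    · exact (mkQ_single_eq_markPoly V hV₀ (hp ▸ Multiset.nodup_range n)).symm
  obtain ⟨f, rfl⟩ := multilinearMk_surjective V n x
  obtain ⟨y, ⟨g, rfl⟩, hy⟩ := h f.2
  refine ⟨g, ?_⟩
  have : Ψ g = ∑ i : Fin n, markMk V n i (g i) := by simp [Ψ, LinearMap.lsum_apply]
  rw [← this]
  exact Subtype.ext hy

theorem codim_le [CharZero k] (hV₀ : V ⊆ diAlgZero k Ω) (n : ℕ) :
    codim V n ≤ n * codim (envelopingVariety V) n := by
  have hker : ∀ i : Fin n, LinearMap.ker (multilinearMk (envelopingVariety V) n) ≤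
      LinearMap.ker (markMk V n i) := fun i => by
    rw [ker_multilinearMk_envelopingVariety V hV₀ n, LinearMap.ker_pi]
    exact iInf_le (fun i : Fin n => LinearMap.ker (markMk V n i)) i
  have h := rank_le_mul_of_ker_le_ker.{u, max u v} (M := multilinearPoly k Ω n)
    (N := multilinearPart (envelopingVariety V) n) (P := multilinearPart V n)
    (multilinearMk (envelopingVariety V) n)
    (multilinearMk_surjective _ n) (fun i : Fin n => markMk V n i) hker
    (exists_sum_markMk V hV₀ n)
  exact h

end Codimension

/-! ### Growth is insensitive to a factor `n` -/

section Growth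

variable {c c' : ℕ → Cardinal.{w}}

/-- Finiteness has to come first: `Cardinal.toNat` sends infinite cardinals to `0` and is monotone
only below a finite bound. -/
theorem lt_aleph0_and_toNat_le_of_le_nat_mul {n : ℕ} (h : c n ≤ n * c' n)
    (h' : c' n < Cardinal.aleph0) :
    c n < Cardinal.aleph0 ∧ ((c n).toNat : ℝ) ≤ n * (c' n).toNat := by
  have hlt : n * c' n < Cardinal.aleph0 := Cardinal.mul_lt_aleph0 Cardinal.natCast_lt_aleph0 h'
  refine ⟨h.trans_lt hlt, ?_⟩
  have := Cardinal.toNat_le_toNat h hlt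
  rw [map_mul, Cardinal.toNat_natCast] at this
  exact_mod_cast this

theorem PolynomialGrowth.of_le_nat_mul (h : ∀ n : ℕ, 1 ≤ n → c n ≤ n * c' n)
    (hc : PolynomialGrowth c') : PolynomialGrowth c := by
  obtain ⟨C, d, hC⟩ := hc
  refine ⟨C, d + 1, fun n hn => ?_⟩
  obtain ⟨h₁, h₂⟩ := lt_aleph0_and_toNat_le_of_le_nat_mul (h n hn) (hC n hn).1
  refine ⟨h₁, h₂.trans ?_⟩
  calc (n : ℝ) * (c' n).toNat ≤ n * (C * n ^ d) := by gcongr; exact (hC n hn).2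
    _ = C * n ^ (d + 1) := by ring

/-- Write `a = √a * √a`: one factor bounds `c'`, the other absorbs `n` by Bernoulli's inequality. -/
theorem SubexponentialGrowth.of_le_nat_mul (h : ∀ n : ℕ, 1 ≤ n → c n ≤ n * c' n)
    (hc : SubexponentialGrowth c') : SubexponentialGrowth c := by
  intro a ha
  have hb : 1 < √a := Real.lt_sqrt_of_sq_lt (by simpa using ha)
  obtain ⟨C, hC⟩ := hc √a hb
  refine ⟨(√a - 1)⁻¹ * C, fun n hn => ?_⟩
  obtain ⟨h₁, h₂⟩ := lt_aleph0_and_toNat_le_of_le_nat_mul (h n hn) (hC n hn).1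
  refine ⟨h₁, h₂.trans ?_⟩
  have hn' : (n : ℝ) ≤ (√a - 1)⁻¹ * √a ^ n := by
    have := one_add_mul_le_pow (a := √a - 1) (by linarith) n
    rw [add_sub_cancel] at this
    rw [le_inv_mul_iff₀ (by linarith)]
    linarith
  -- `C` is not assumed nonnegative; the sign comes from the bounded quantity.
  have hC₀ : 0 ≤ C * √a ^ n := (Nat.cast_nonneg _).trans (hC n hn).2
  calc (n : ℝ) * (c' n).toNat ≤ n * (C * √a ^ n) := by gcongr; exact (hC n hn).2
    _ ≤ ((√a - 1)⁻¹ * √a ^ n) * (C * √a ^ n) := by gcongr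
    _ = (√a - 1)⁻¹ * C * (√a * √a) ^ n := by ring
    _ = (√a - 1)⁻¹ * C * a ^ n := by rw [Real.mul_self_sqrt (by linarith)]

end Growth

theorem theorem4 (k : Type u) [Field k] [CharZero k] (Ω : Type v)
    (V : Set (OmegaAlg.{u, v, max u v} k (DiOp Ω))) (hV : IsVariety V)
    (hV₀ : V ⊆ diAlgZero k Ω) :
    (∀ n : ℕ, 1 ≤ n → codim V n ≤ (n : Cardinal) * codim (envelopingVariety V) n) ∧
    (∀ n : ℕ, 1 ≤ n → codim (envelopingVariety V) n ≤ (n : Cardinal) * codim V n) ∧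
    (PolynomialGrowth (codim V) ↔ PolynomialGrowth (codim (envelopingVariety V))) ∧
    (IntermediateGrowth (codim V) ↔ IntermediateGrowth (codim (envelopingVariety V))) := by
  have h₁ : ∀ n : ℕ, 1 ≤ n → codim V n ≤ n * codim (envelopingVariety V) n :=
    fun n _ => codim_le V hV₀ n
  have h₂ : ∀ n : ℕ, 1 ≤ n → codim (envelopingVariety V) n ≤ n * codim V n :=
    fun n _ => codim_envelopingVariety_le V hV₀ n
  have hpoly : PolynomialGrowth (codim V) ↔ PolynomialGrowth (codim (envelopingVariety V)) :=
    ⟨.of_le_nat_mul h₂, .of_le_nat_mul h₁⟩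
  exact ⟨h₁, h₂, hpoly, and_congr ⟨.of_le_nat_mul h₂, .of_le_nat_mul h₁⟩ hpoly.not⟩
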